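/- Let $\mathbb{k}$ be a field of characteristic $p>0$, let $n\ge 1$, and let $\sigma=(s_{i,j})_{1\le i,j\le n}$ be a shift matrix, i.e. an array of non-negative integers such that $s_{i,j}+s_{j,k}=s_{i,k}$ whenever $|i-j|+|j-k|=|i-k|$. Let $\mathfrak{gl}_n[t]=\mathfrak{gl}_n(\mathbb{k})\otimes\mathbb{k}[t]=\mathfrak{gl}_n(\mathbb{k}[t])$ be the current Lie algebra over $\mathbb{k}$, with commutator bracket, and write $e_{i,j}t^r$ for the matrix with entry $t^r$ in position $(i,j)$ and zeros elsewhere. Let $\mathfrak{g}_\sigma\subseteq\mathfrak{gl}_n[t]$ be the shifted current algebra, the Lie subalgebra spanned by all $e_{i,j}t^r$ with $1\le i,j\le n$ and $r\ge s_{i,j}$. It is a restricted Lie algebra, with $p$-map $x\mapsto x^{[p]}$ given by the $p$-th power of matrices over $\mathbb{k}[t]$, so that $(e_{i,j}t^r)^{[p]}=\delta_{i,j}e_{i,j}t^{rp}$. Let $U(\mathfrak{g}_\sigma)$ be the universal enveloping algebra, $Z(\mathfrak{g}_\sigma)$ its centre, $Z_p(\mathfrak{g}_\sigma)$ (the $p$-centre)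 the subalgebra of $U(\mathfrak{g}_\sigma)$ generated by the elements $x^p-x^{[p]}$ for all $x\in\mathfrak{g}_\sigma$, and $z_r:=e_{1,1}t^r+\cdots+e_{n,n}t^r\in\mathfrak{g}_\sigma$ for $r\ge 0$. Then $Z(\mathfrak{g}_\sigma)$ is generated, as a $\mathbb{k}$-algebra, by $\{z_r \mid r\ge 0\}$ and $Z_p(\mathfrak{g}_\sigma)$. In fact, $Z(\mathfrak{g}_\sigma)$ is freely generated, as a commutative $\mathbb{k}$-algebra, by $$\{z_r \mid r\ge 0\}\ \cup\ \big\{(e_{i,j}t^r)^p-\delta_{i,j}e_{i,j}t^{rp}\ \big|\ 1\le i,j\le n \text{ with } (i,j)\ne(1,1),\ r\ge s_{i,j}\big\}.$$ That is, $Z(\mathfrak{g}_\sigma)$ is the polynomial algebra in these elements, which are pairwise distinct and algebraically independent. -/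

import Mathlib

attribute [local instance 100] LieRing.ofAssociativeRing

/-- An `n × n` shift matrix: an array of natural numbers with
`s i j + s j l = s i l` whenever `|i - j| + |j - l| = |i - l|`. -/
structure ShiftMatrix (n : ℕ) where
  s : Fin n → Fin n → ℕ
  add_eq : ∀ i j l : Fin n,
    |(i : ℤ) - (j : ℤ)| + |(j : ℤ) - (l : ℤ)| = |(i : ℤ) - (l : ℤ)| → s i j + s j l = s i l

namespace ShiftMatrix

variable {n : ℕ} (σ : ShiftMatrix n)

theorem diag (i : Fin n) : σ.s i i = 0 := by
  have := σ.add_eq i i i (by simp)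
  omega

theorem triangle (i j l : Fin n) : σ.s i l ≤ σ.s i j + σ.s j l := by
  have key : ∀ a b c : Fin n,
      ((a : ℕ) ≤ b ∧ (b : ℕ) ≤ c) ∨ ((c : ℕ) ≤ b ∧ (b : ℕ) ≤ a) → σ.s a b + σ.s b c = σ.s a c := by
    intro a b c h
    apply σ.add_eq
    rcases h with ⟨h1, h2⟩ | ⟨h1, h2⟩
    · rw [abs_of_nonpos (by omega), abs_of_nonpos (by omega), abs_of_nonpos (by omega)]; ring
    · rw [abs_of_nonneg (by omega), abs_of_nonneg (by omega), abs_of_nonneg (by omega)]; ring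
  have h1 := key i j l
  have h2 := key i l j
  have h3 := key j i l
  have h4 := key l i j
  omega

end ShiftMatrix

noncomputable section

/-- The current algebra `𝔤𝔩ₙ[t] = 𝔤𝔩ₙ ⊗ k[t]`, realised as the `n × n` matrices over `k[t]`
with the commutator bracket; it is viewed as a Lie algebra over `k`. -/
abbrev CurrentAlgebra (k : Type*) [Field k] (n : ℕ) : Type _ :=
  Matrix (Fin n) (Fin n) (Polynomial k)

namespace CurrentAlgebra

variable (k : Type*) [Field k] {n : ℕ}

/-- The element `e_{i,j} t^r`. -/
def e (i j : Fin n) (r : ℕ) : CurrentAlgebra k n :=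
  Matrix.single i j (Polynomial.X ^ r)

theorem e_mul_e (i j a b : Fin n) (r s : ℕ) :
    e k i j r * e k a b s = if j = a then e k i b (r + s) else 0 := by
  unfold e
  split_ifs with h
  · subst h
    rw [Matrix.single_mul_single_same, pow_add]
  · exact Matrix.single_mul_single_of_ne _ _ _ _ h _

theorem lie_e_e (i j a b : Fin n) (r s : ℕ) :
    ⁅e k i j r, e k a b s⁆ =
      (if a = j then e k i b (r + s) else 0) - (if b = i then e k a j (r + s) else 0) := by
  rw [Ring.lie_def, e_mul_e, e_mul_e, add_comm s r]
  simp only [eq_comm]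

end CurrentAlgebra

/-- The span of the `e_{i,j} t^r` with `r ≥ s_{i,j}`. -/
def shiftedSpan (k : Type*) [Field k] {n : ℕ} (σ : ShiftMatrix n) :
    Submodule k (CurrentAlgebra k n) :=
  Submodule.span k {x | ∃ (i j : Fin n) (r : ℕ), σ.s i j ≤ r ∧ x = CurrentAlgebra.e k i j r}

section

variable (k : Type*) [Field k] {n : ℕ} (σ : ShiftMatrix n)

theorem e_mem_shiftedSpan (i j : Fin n) (r : ℕ) (h : σ.s i j ≤ r) :
    CurrentAlgebra.e k i j r ∈ shiftedSpan k σ :=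
  Submodule.subset_span ⟨i, j, r, h, rfl⟩

theorem one_mem_shiftedSpan : (1 : CurrentAlgebra k n) ∈ shiftedSpan k σ := by
  have h : (1 : CurrentAlgebra k n) = ∑ i : Fin n, CurrentAlgebra.e k i i 0 := by
    simp only [CurrentAlgebra.e, pow_zero]
    exact Matrix.sum_single_one.symm
  rw [h]
  exact Submodule.sum_mem _ fun i _ => e_mem_shiftedSpan k σ i i 0 (σ.diag i).le

variable {k}

theorem mul_mem_shiftedSpan {x y : CurrentAlgebra k n} (hx : x ∈ shiftedSpan k σ)
    (hy : y ∈ shiftedSpan k σ) : x * y ∈ shiftedSpan k σ := by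
  have hle : shiftedSpan k σ * shiftedSpan k σ ≤ shiftedSpan k σ := by
    unfold shiftedSpan
    rw [Submodule.span_mul_span, Submodule.span_le]
    rintro _ ⟨_, ⟨i, j, r, hr, rfl⟩, _, ⟨a, b, s, hs, rfl⟩, rfl⟩
    simp only [CurrentAlgebra.e_mul_e]
    split_ifs with h
    · subst h
      exact e_mem_shiftedSpan k σ i b (r + s) ((σ.triangle i j b).trans (add_le_add hr hs))
    · exact Submodule.zero_mem _
  exact hle (Submodule.mul_mem_mul hx hy)

theorem pow_mem_shiftedSpan {x : CurrentAlgebra k n} (hx : x ∈ shiftedSpan k σ) (m : ℕ) :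
    x ^ m ∈ shiftedSpan k σ := by
  induction m with
  | zero => rw [pow_zero]; exact one_mem_shiftedSpan k σ
  | succ m ih => rw [pow_succ]; exact mul_mem_shiftedSpan σ ih hx

end

/-- The shifted current algebra `𝔤_σ`. -/
def shiftedCurrentAlgebra (k : Type*) [Field k] {n : ℕ} (σ : ShiftMatrix n) :
    LieSubalgebra k (CurrentAlgebra k n) :=
  { shiftedSpan k σ with
    lie_mem' := fun {x y} hx hy => by
      rw [Ring.lie_def]
      exact Submodule.sub_mem _ (mul_mem_shiftedSpan σ hx hy) (mul_mem_shiftedSpan σ hy hx) }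

namespace shiftedCurrentAlgebra

variable (k : Type*) [Field k] {n : ℕ} (σ : ShiftMatrix n)

/-- The element `e_{i,j} t^r` of `𝔤_σ`, for `r ≥ s_{i,j}`. -/
def e (i j : Fin n) (r : ℕ) (h : σ.s i j ≤ r) : shiftedCurrentAlgebra k σ :=
  ⟨CurrentAlgebra.e k i j r, e_mem_shiftedSpan k σ i j r h⟩

/-- The element `z_r = e_{1,1} t^r + ⋯ + e_{n,n} t^r` of `𝔤_σ`. -/
def z (r : ℕ) : shiftedCurrentAlgebra k σ :=
  ∑ i : Fin n, e k σ i i r ((σ.diag i).le.trans (Nat.zero_le r))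

/-- The element `δ_{i,j} e_{i,j} t^r` of `𝔤_σ`. -/
def deltaE (i j : Fin n) (r : ℕ) : shiftedCurrentAlgebra k σ :=
  if h : i = j then e k σ i j r (by rw [h, σ.diag]; exact Nat.zero_le r) else 0

variable {k}

/-- The `p`-map `x ↦ x^{[p]}` of `𝔤_σ`: the restriction of the `p`-map of `𝔤𝔩ₙ(k[t])`, which is
the `p`-th power of matrices. -/
def pMap (p : ℕ) (x : shiftedCurrentAlgebra k σ) : shiftedCurrentAlgebra k σ :=
  ⟨(x : CurrentAlgebra k n) ^ p, pow_mem_shiftedSpan σ x.2 p⟩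

/-- On basis vectors, `(e_{i,j} t^r)^{[p]} = δ_{i,j} e_{i,j} t^{rp}`. -/
theorem pMap_e (p : ℕ) (hp : 2 ≤ p) (i j : Fin n) (r : ℕ) (h : σ.s i j ≤ r) :
    pMap σ p (e k σ i j r h) = deltaE k σ i j (r * p) := by
  apply Subtype.ext
  unfold deltaE
  by_cases hij : i = j
  · subst hij
    rw [dif_pos rfl]
    change CurrentAlgebra.e k i i r ^ p = CurrentAlgebra.e k i i (r * p)
    obtain ⟨m, rfl⟩ : ∃ m, p = m + 1 := ⟨p - 1, by omega⟩
    clear hp h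
    induction m with
    | zero => simp
    | succ m ih =>
      rw [pow_succ, ih, CurrentAlgebra.e_mul_e, if_pos rfl]
      congr 1
  · rw [dif_neg hij]
    change CurrentAlgebra.e k i j r ^ p = 0
    obtain ⟨m, rfl⟩ : ∃ m, p = m + 2 := ⟨p - 2, by omega⟩
    rw [pow_add, pow_two, CurrentAlgebra.e_mul_e, if_neg (Ne.symm hij), mul_zero]

variable (k)

/-- The enveloping algebra `U(𝔤_σ)`. -/
abbrev U : Type _ := UniversalEnvelopingAlgebra k (shiftedCurrentAlgebra k σ)

/-- The canonical map `𝔤_σ → U(𝔤_σ)`. -/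
abbrev toU : shiftedCurrentAlgebra k σ →ₗ⁅k⁆ U k σ := UniversalEnvelopingAlgebra.ι k

/-- The `p`-centre `Z_p(𝔤_σ)`: the subalgebra of `U(𝔤_σ)` generated by all `x^p - x^{[p]}`,
`x ∈ 𝔤_σ`. -/
def pCentre (p : ℕ) : Subalgebra k (U k σ) :=
  Algebra.adjoin k (Set.range fun x : shiftedCurrentAlgebra k σ =>
    toU k σ x ^ p - toU k σ (pMap σ p x))

variable {k}

/-- The triples `(i, j, r)` with `(i, j) ≠ (1, 1)` and `r ≥ s_{i,j}`; the indices `1, …, n` are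
the elements `0, …, n - 1` of `Fin n`. -/
def Index [NeZero n] : Type :=
  {b : Fin n × Fin n × ℕ // (b.1, b.2.1) ≠ (0, 0) ∧ σ.s b.1 b.2.1 ≤ b.2.2}

variable (k)

/-- The family consisting of the `z_r` for `r ≥ 0` and of the
`(e_{i,j} t^r)^p - δ_{i,j} e_{i,j} t^{rp}` for `(i, j) ≠ (1, 1)` and `r ≥ s_{i,j}`. -/
def centreGen (p : ℕ) [NeZero n] : ℕ ⊕ Index σ → U k σ
  | Sum.inl r => toU k σ (z k σ r)
  | Sum.inr ⟨(i, j, r), h⟩ => toU k σ (e k σ i j r h.2) ^ p - toU k σ (deltaE k σ i j (r * p))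

end shiftedCurrentAlgebra

/-- The subalgebra `Z` is freely generated, as a commutative algebra, by the family `g`: the
assignment `X_b ↦ g b` defines an isomorphism from the polynomial algebra onto `Z`. -/
def IsFreelyGeneratedBy {k A B : Type*} [CommRing k] [Ring A] [Algebra k A]
    (Z : Subalgebra k A) (g : B → A) : Prop :=
  ∃ φ : MvPolynomial B k ≃ₐ[k] Z, ∀ b, (φ (MvPolynomial.X b) : A) = g b

end

/-! The bracket of `𝔤_σ` is the commutator of an associative product, matrix multiplication. Letting
`x` act on the symmetric algebra `S` as multiplication by `x` plus the derivation extending left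
multiplication by `x` makes `S` a module over the enveloping algebra `U`. The map `u ↦ u · 1`
(`toSym`) is injective, preserves leading terms and intertwines the adjoint actions, so it carries
central elements to invariants of `S` (`toSym_injective`, `symAd_toSym`).

The invariants are bounded by a shift trick. A polynomial `f` involves only finitely many powers of
`t`, so entry functionals at a large power `t^m` vanish on its variables. Composing such a
functional with a suitable `ad x` gives any coordinate other than those of the `z_r`, and invariance
then makes the corresponding partial derivative of `f` vanish (`pderiv_eq_zero_of_invariant`). In
characteristic `p`, `f` is thus a polynomial in the `z_r` and the `p`-th powers of the other
variables.

These are exactly the leading terms of the proposed generators, which are central because `ad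
(x^[p]) = (ad x)^p`. Comparison of leading terms and induction on degree give algebraic independence
and generation (`aeval_injective`, `aeval_surjective`). -/

/-! ### Degree filtration of a polynomial ring and symbols of operators. -/

namespace MvPolynomial

variable {k B : Type*} [Field k]

/-- The polynomials all of whose monomials have degree less than `N`. -/
noncomputable def degLT (k B : Type*) [Field k] (N : ℕ) : Submodule k (MvPolynomial B k) :=
  restrictSupport k {m | m.degree < N}

theorem mem_degLT {N : ℕ} {f : MvPolynomial B k} :
    f ∈ degLT k B N ↔ ∀ m ∈ f.support, m.degree < N :=
  mem_restrictSupport_iff k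

theorem degLT_mono {M N : ℕ} (h : M ≤ N) : degLT k B M ≤ degLT k B N :=
  restrictSupport_mono k fun _ hm => lt_of_lt_of_le hm h

/-- The degree bound is strict so that inductions on it can start from the zero polynomial. -/
theorem degLT_zero : degLT k B 0 = ⊥ := by
  refine (Submodule.eq_bot_iff _).2 fun f hf => ?_
  rw [mem_degLT] at hf
  exact support_eq_empty.1 (Finset.eq_empty_of_forall_notMem fun m hm => by simpa using hf m hm)

theorem exists_mem_degLT (f : MvPolynomial B k) : ∃ N, f ∈ degLT k B (N + 1) :=
  ⟨f.support.sup Finsupp.degree, mem_degLT.2 fun _ hm => Nat.lt_succ_of_le (Finset.le_sup hm)⟩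

theorem monomial_mem_degLT {N : ℕ} {m : B →₀ ℕ} (c : k) (h : m.degree < N) :
    monomial m c ∈ degLT k B N :=
  (monomial_mem_restrictSupport k).2 (Or.inl h)

theorem one_mem_degLT : (1 : MvPolynomial B k) ∈ degLT k B 1 :=
  monomial_mem_degLT 1 (by simp)

theorem X_mem_degLT (b : B) : (X b : MvPolynomial B k) ∈ degLT k B 2 :=
  monomial_mem_degLT 1 (by simp)

theorem mul_mem_degLT {M N : ℕ} {f g : MvPolynomial B k} (hf : f ∈ degLT k B (M + 1))
    (hg : g ∈ degLT k B N) : f * g ∈ degLT k B (M + N) := by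
  classical
  rw [mem_degLT] at *
  intro m hm
  obtain ⟨a, ha, b, hb, rfl⟩ := Finset.mem_add.1 (support_mul f g hm)
  have h1 := hf a ha
  have h2 := hg b hb
  rw [map_add]
  omega

/-- A linear map sending every monomial of degree `d` to `degLT k B (d + e + 1)` raises the degree
by at most `e`. -/
theorem map_mem_degLT (T : MvPolynomial B k →ₗ[k] MvPolynomial B k) (e : ℕ)
    (h : ∀ m, T (monomial m 1) ∈ degLT k B (m.degree + e + 1)) {N : ℕ} {f : MvPolynomial B k}
    (hf : f ∈ degLT k B N) : T f ∈ degLT k B (N + e) := by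
  rw [mem_degLT] at hf
  rw [f.as_sum, map_sum]
  refine Submodule.sum_mem _ fun m hm => ?_
  have h2 := hf m hm
  rw [← mul_one (coeff m f), ← smul_eq_mul, ← smul_monomial, map_smul]
  exact Submodule.smul_mem _ _ (degLT_mono (by omega) (h m))

theorem derivation_mem_degLT (D : Derivation k (MvPolynomial B k) (MvPolynomial B k))
    (hD : ∀ b, D (X b) ∈ degLT k B 2) {N : ℕ} {f : MvPolynomial B k} (hf : f ∈ degLT k B N) :
    D f ∈ degLT k B N := by
  have hE : D = mkDerivation k fun b => D (X b) := derivation_ext fun i => by simp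
  refine map_mem_degLT D.toLinearMap 0 (fun m => ?_) hf
  change D (monomial m 1) ∈ _
  rw [hE, mkDerivation_monomial, one_smul, Finsupp.sum]
  refine Submodule.sum_mem _ fun i hi => ?_
  have hle : Finsupp.single i 1 ≤ m := by
    rw [Finsupp.single_le_iff]
    exact Nat.one_le_iff_ne_zero.2 (Finsupp.mem_support_iff.1 hi)
  have hd : m.degree = (m - Finsupp.single i 1).degree + 1 := by
    conv_lhs => rw [← tsub_add_cancel_of_le hle, map_add, Finsupp.degree_single]
  rw [hd, smul_eq_mul]
  exact mul_mem_degLT (N := 2) (monomial_mem_degLT _ (by omega)) (hD i)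

/-- The operator `T` agrees with multiplication by `s`, a polynomial of degree at most `d`, up to
terms of lower degree. -/
structure HasSymbol (T : Module.End k (MvPolynomial B k)) (s : MvPolynomial B k) (d : ℕ) :
    Prop where
  mem : s ∈ degLT k B (d + 1)
  sub_mem : ∀ {N : ℕ} {f : MvPolynomial B k}, f ∈ degLT k B (N + 1) →
    T f - s * f ∈ degLT k B (N + d)

namespace HasSymbol

variable {T T' : Module.End k (MvPolynomial B k)} {s s' : MvPolynomial B k} {d d' : ℕ}

theorem map_mem (h : HasSymbol T s d) {N : ℕ} {f : MvPolynomial B k} (hf : f ∈ degLT k B N) :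
    T f ∈ degLT k B (N + d) := by
  cases N with
  | zero =>
    rw [degLT_zero, Submodule.mem_bot] at hf
    rw [hf, map_zero]
    exact Submodule.zero_mem _
  | succ N =>
    rw [← sub_add_cancel (T f) (s * f)]
    refine Submodule.add_mem _ (degLT_mono (by omega) (h.sub_mem hf)) ?_
    rw [add_comm]
    exact mul_mem_degLT h.mem hf

theorem one : HasSymbol (1 : Module.End k (MvPolynomial B k)) 1 0 :=
  ⟨one_mem_degLT, fun _ => by simp⟩

theorem mul (h : HasSymbol T s d) (h' : HasSymbol T' s' d') :
    HasSymbol (T * T') (s * s') (d + d') := by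
  refine ⟨degLT_mono (by omega) (mul_mem_degLT h.mem h'.mem), fun {N f} hf => ?_⟩
  have h1 := h.map_mem (h'.sub_mem hf)
  have h2 := mul_mem_degLT h'.mem hf
  rw [← add_assoc] at h2
  have h3 := h.sub_mem h2
  have : (T * T') f - s * s' * f = T (T' f - s' * f) + (T (s' * f) - s * (s' * f)) := by
    rw [map_sub, Module.End.mul_apply]
    ring
  rw [this]
  exact Submodule.add_mem _ (degLT_mono (by omega) h1) (degLT_mono (by omega) h3)

theorem pow (h : HasSymbol T s d) (n : ℕ) : HasSymbol (T ^ n) (s ^ n) (n * d) := by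
  induction n with
  | zero => simpa using one
  | succ n ih =>
    rw [pow_succ, pow_succ, Nat.succ_mul]
    exact ih.mul h

/-- Lets the term `x^[p]`, of degree 1, be ignored against `x^p`, of degree `p`. -/
theorem sub_of_lt (h : HasSymbol T s d) (h' : HasSymbol T' s' d') (hd : d' < d) :
    HasSymbol (T - T') s d := by
  refine ⟨h.mem, fun {N f} hf => ?_⟩
  rw [LinearMap.sub_apply, sub_right_comm]
  exact Submodule.sub_mem _ (h.sub_mem hf) (degLT_mono (by omega) (h'.map_mem hf))

theorem sub_apply_one_mem (h : HasSymbol T s d) : T 1 - s ∈ degLT k B d := by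
  simpa using h.sub_mem one_mem_degLT

end HasSymbol

end MvPolynomial

/-! ### Generation of the enveloping algebra and its centre. -/

namespace UniversalEnvelopingAlgebra

variable {k g : Type*} [CommRing k] [LieRing g] [LieAlgebra k g]

/-- By the universal property, `ι` corestricted to `A` lifts to a map from the whole algebra to `A`;
followed by the inclusion it fixes every `ι x`, hence is the identity. -/
theorem adjoin_range_ι :
    Algebra.adjoin k (Set.range (ι k : g → UniversalEnvelopingAlgebra k g)) = ⊤ := by
  set A := Algebra.adjoin k (Set.range (ι k : g → UniversalEnvelopingAlgebra k g))
  let f : g →ₗ⁅k⁆ A :=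
    { toFun := fun x => ⟨ι k x, Algebra.subset_adjoin ⟨x, rfl⟩⟩
      map_add' := fun x y => Subtype.ext (map_add (ι k) x y)
      map_smul' := fun c x => Subtype.ext (map_smul (ι k) c x)
      map_lie' := fun {x y} => Subtype.ext (LieHom.map_lie (ι k) x y) }
  have h : A.val.comp (lift k f) = AlgHom.id k _ := by
    refine hom_ext (R := k) (LieHom.ext fun x => ?_)
    change ((lift k f (ι k x) : A) : UniversalEnvelopingAlgebra k g) = ι k x
    rw [lift_ι_apply]
    rfl
  refine eq_top_iff.2 fun u _ => ?_
  have := DFunLike.congr_fun h u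
  change ((lift k f u : A) : UniversalEnvelopingAlgebra k g) = u at this
  rw [← this]
  exact Subtype.property _

theorem mem_center_iff_lie {u : UniversalEnvelopingAlgebra k g} :
    u ∈ Subalgebra.center k (UniversalEnvelopingAlgebra k g) ↔
      ∀ x : g, ι k x * u = u * ι k x := by
  refine ⟨fun h x => Subalgebra.mem_center_iff.1 h _, fun h => ?_⟩
  have hle : Algebra.adjoin k (Set.range (ι k : g → UniversalEnvelopingAlgebra k g)) ≤
      Subalgebra.centralizer k {u} := by
    rw [Algebra.adjoin_le_iff]
    rintro _ ⟨x, rfl⟩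
    exact Subalgebra.mem_centralizer_iff k |>.2 fun y hy => by rw [hy, h x]
  rw [adjoin_range_ι] at hle
  refine Subalgebra.mem_center_iff.2 fun b => ?_
  exact ((Subalgebra.mem_centralizer_iff k).1 (hle (Algebra.mem_top (x := b))) u rfl).symm

end UniversalEnvelopingAlgebra

/-! ### Polynomials in powers of the variables. -/

namespace MvPolynomial

variable {k B P : Type*} [Field k]

theorem linearMap_apply_eq_sum {V : Type*} [AddCommGroup V] [Module k V]
    (T : MvPolynomial P k →ₗ[k] V) (f : MvPolynomial P k) :
    T f = ∑ m ∈ f.support, coeff m f • T (monomial m 1) := by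
  conv_lhs => rw [f.as_sum, map_sum]
  refine Finset.sum_congr rfl fun m _ => ?_
  rw [← map_smul, smul_monomial, smul_eq_mul, mul_one]

theorem sub_mem_degLT_of_monomial (T T' : MvPolynomial P k →ₗ[k] MvPolynomial B k)
    (e : (P →₀ ℕ) → ℕ) (h : ∀ m, T (monomial m 1) - T' (monomial m 1) ∈ degLT k B (e m))
    {f : MvPolynomial P k} {N : ℕ} (hf : ∀ m ∈ f.support, e m < N + 1) :
    T f - T' f ∈ degLT k B N := by
  rw [← LinearMap.sub_apply, linearMap_apply_eq_sum]
  refine Submodule.sum_mem _ fun m hm => Submodule.smul_mem _ _ ?_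
  exact degLT_mono (Nat.lt_succ_iff.1 (hf m hm)) (h m)

/-- The exponent vector `m` with the exponent of `b` multiplied by `w b`. -/
noncomputable def scaleExp (w : B → ℕ) : (B →₀ ℕ) →+ (B →₀ ℕ) where
  toFun m := Finsupp.onFinset m.support (fun b => w b * m b)
    fun b hb => Finsupp.mem_support_iff.2 (right_ne_zero_of_mul hb)
  map_zero' := by ext; simp
  map_add' := fun a b => by ext; simp [mul_add]

theorem scaleExp_apply (w : B → ℕ) (m : B →₀ ℕ) (b : B) : scaleExp w m b = w b * m b := rfl

theorem scaleExp_single (w : B → ℕ) (b : B) (n : ℕ) :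
    scaleExp w (Finsupp.single b n) = Finsupp.single b (w b * n) := by
  classical
  ext c
  rw [scaleExp_apply]
  by_cases h : b = c
  · subst h; simp
  · simp [Finsupp.single_eq_of_ne' h]

theorem scaleExp_injective {w : B → ℕ} (hw : ∀ b, w b ≠ 0) :
    Function.Injective (scaleExp w) := fun m m' h => by
  ext b
  have := DFunLike.congr_fun h b
  exact Nat.eq_of_mul_eq_mul_left (Nat.pos_of_ne_zero (hw b)) this

/-- The linear map `X^m ↦ X^{w m}`. -/
noncomputable def scale (w : B → ℕ) : MvPolynomial B k →ₗ[k] MvPolynomial B k :=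
  (basisMonomials B k).constr k fun m => monomial (scaleExp w m) 1

theorem scale_monomial (w : B → ℕ) (m : B →₀ ℕ) :
    scale w (monomial m (1 : k)) = monomial (scaleExp w m) 1 := by
  have := (basisMonomials B k).constr_basis k (fun m => monomial (scaleExp w m) (1 : k)) m
  rwa [coe_basisMonomials] at this

theorem coeff_scale {w : B → ℕ} (hw : ∀ b, w b ≠ 0) (m : B →₀ ℕ) (f : MvPolynomial B k) :
    coeff (scaleExp w m) (scale w f) = coeff m f := by
  classical
  have : (lcoeff k (scaleExp w m)) ∘ₗ scale w = lcoeff k m := by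
    refine (basisMonomials B k).ext fun m' => ?_
    simp [scale_monomial, lcoeff_apply, coeff_monomial, (scaleExp_injective hw).eq_iff]
  exact DFunLike.congr_fun this f

theorem scale_injective {w : B → ℕ} (hw : ∀ b, w b ≠ 0) :
    Function.Injective (scale w : MvPolynomial B k → _) := fun f g h => by
  ext m
  rw [← coeff_scale hw, h, coeff_scale hw]

theorem mem_range_scale {w : B → ℕ} (f : MvPolynomial B k)
    (h : ∀ m ∈ f.support, ∀ b, w b ∣ m b) : ∃ g, scale w g = f := by
  have : ∀ m ∈ f.support, monomial m 1 ∈ LinearMap.range (scale (k := k) w) := fun m hm => by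
    let m' : B →₀ ℕ := Finsupp.onFinset m.support (fun b => m b / w b) fun b hb =>
      Finsupp.mem_support_iff.2 fun h0 => hb (by rw [h0, Nat.zero_div])
    have hm' : scaleExp w m' = m := Finsupp.ext fun b => Nat.mul_div_cancel' (h m hm b)
    exact ⟨monomial m' 1, by rw [scale_monomial, hm']⟩
  have hf := linearMap_apply_eq_sum LinearMap.id f
  rw [LinearMap.id_apply] at hf
  rw [hf]
  exact Submodule.sum_mem _ fun m hm => Submodule.smul_mem _ _ (this m hm)

/-- The coefficient of `X^m / X_b` in the derivative is `m b` times that of `X^m` in `f`, so `m b`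
must vanish in `k`. -/
theorem dvd_of_pderiv_eq_zero (p : ℕ) [CharP k p] {f : MvPolynomial B k} {b : B}
    (h : pderiv b f = 0) {m : B →₀ ℕ} (hm : m ∈ f.support) : p ∣ m b := by
  by_cases h0 : m b = 0
  · rw [h0]; exact dvd_zero p
  have hle : Finsupp.single b 1 ≤ m := by
    rw [Finsupp.single_le_iff]; omega
  have h1 := coeff_pderiv (i := b) f (m - Finsupp.single b 1)
  rw [h, coeff_zero, tsub_add_cancel_of_le hle] at h1
  have h2 := (mul_eq_zero.1 h1.symm).resolve_left (mem_support_iff.1 hm)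
  rw [← CharP.cast_eq_zero_iff k p]
  have h3 : m b = (m - Finsupp.single b 1 : B →₀ ℕ) b + 1 := by
    rw [Finsupp.tsub_apply, Finsupp.single_eq_same]; omega
  rw [h3, Nat.cast_add, Nat.cast_one]
  exact_mod_cast h2

end MvPolynomial

/-! ### The module structure on the symmetric algebra and the injection of the enveloping algebra.
-/

open MvPolynomial UniversalEnvelopingAlgebra

/-- An associative bilinear product on a Lie algebra whose commutator is the Lie bracket. -/
structure AssocProduct (k g : Type*) [Field k] [LieRing g] [LieAlgebra k g] where
  mul : g →ₗ[k] g →ₗ[k] g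
  assoc : ∀ x y z, mul (mul x y) z = mul x (mul y z)
  lie_eq : ∀ x y, ⁅x, y⁆ = mul x y - mul y x

namespace AssocProduct

variable {k g B : Type*} [Field k] [LieRing g] [LieAlgebra k g]
  (P : AssocProduct k g) (v : Module.Basis B k g)

/-- The inclusion of `g` into its symmetric algebra. -/
noncomputable def lin : g →ₗ[k] MvPolynomial B k := v.constr k X

theorem lin_basis (b : B) : lin v (v b) = X b := v.constr_basis k _ b

theorem lin_mem_degLT (x : g) : lin v x ∈ degLT k B 2 := by
  rw [lin, Module.Basis.constr_apply]
  exact Submodule.sum_mem _ fun b _ => Submodule.smul_mem _ _ (X_mem_degLT b)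

/-- The derivation of the symmetric algebra extending a linear endomorphism of `g`. -/
noncomputable def extDer (T : g →ₗ[k] g) : Derivation k (MvPolynomial B k) (MvPolynomial B k) :=
  mkDerivation k fun b => lin v (T (v b))

theorem extDer_lin (T : g →ₗ[k] g) (x : g) : extDer v T (lin v x) = lin v (T x) := by
  have : (extDer v T).toLinearMap ∘ₗ lin v = lin v ∘ₗ T := v.ext fun b => by
    change extDer v T (lin v (v b)) = _
    rw [lin_basis, extDer, mkDerivation_X]
    rfl
  exact DFunLike.congr_fun this x

theorem extDer_add (T T' : g →ₗ[k] g) : extDer v (T + T') = extDer v T + extDer v T' :=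
  derivation_ext fun b => by simp [extDer]

theorem extDer_smul (c : k) (T : g →ₗ[k] g) : extDer v (c • T) = c • extDer v T :=
  derivation_ext fun b => by simp [extDer]

theorem extDer_lie (T T' : g →ₗ[k] g) : extDer v ⁅T, T'⁆ = ⁅extDer v T, extDer v T'⁆ :=
  derivation_ext fun b => by
    rw [Derivation.commutator_apply, ← lin_basis v b]
    simp only [extDer_lin, ← map_sub]
    rfl

theorem extDer_mem_degLT (T : g →ₗ[k] g) {N : ℕ} {f : MvPolynomial B k} (hf : f ∈ degLT k B N) :
    extDer v T f ∈ degLT k B N :=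
  derivation_mem_degLT _ (fun b => by rw [← lin_basis v b, extDer_lin]; exact lin_mem_degLT v _) hf

/-- Associativity makes left multiplication a Lie algebra representation. -/
theorem mul_lie_mul (x y : g) : ⁅P.mul x, P.mul y⁆ = P.mul ⁅x, y⁆ := by
  ext z
  rw [P.lie_eq, map_sub, LinearMap.sub_apply, P.assoc, P.assoc]
  rfl

/-- Inner derivations of the associative product are its commutators, so `ad x` obeys the Leibniz
rule for `P.mul`. -/
theorem ad_lie_mul (x y : g) : ⁅(LieAlgebra.ad k g x : g →ₗ[k] g), P.mul y⁆ = P.mul ⁅x, y⁆ := by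
  ext z
  change ⁅x, P.mul y z⁆ - P.mul y ⁅x, z⁆ = _
  simp only [P.lie_eq, map_sub, LinearMap.sub_apply, P.assoc]
  abel

/-- The representation of `g` on its symmetric algebra in which `x` acts by multiplication by `x`
plus the derivation extending left multiplication by `x`. -/
noncomputable def symRep : g →ₗ⁅k⁆ Module.End k (MvPolynomial B k) where
  toFun x := LinearMap.mulLeft k (lin v x) + (extDer v (P.mul x)).toLinearMap
  map_add' x y := by
    refine LinearMap.ext fun f => ?_
    simp only [map_add, extDer_add, LinearMap.add_apply, LinearMap.mulLeft_apply, add_mul]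
    change _ + (extDer v (P.mul x) f + extDer v (P.mul y) f) =
      _ + extDer v (P.mul x) f + (_ + extDer v (P.mul y) f)
    ring
  map_smul' c x := by
    refine LinearMap.ext fun f => ?_
    simp only [map_smul, extDer_smul, LinearMap.add_apply, LinearMap.mulLeft_apply, smul_mul_assoc,
      RingHom.id_apply, LinearMap.smul_apply, smul_add]
    rfl
  map_lie' {x y} := by
    refine LinearMap.ext fun f => ?_
    rw [← P.mul_lie_mul, extDer_lie, P.lie_eq, Ring.lie_def]
    change lin v _ * f + ⁅extDer v (P.mul x), extDer v (P.mul y)⁆ f =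
      (lin v x * (lin v y * f + extDer v (P.mul y) f) +
        extDer v (P.mul x) (lin v y * f + extDer v (P.mul y) f)) -
      (lin v y * (lin v x * f + extDer v (P.mul x) f) +
        extDer v (P.mul y) (lin v x * f + extDer v (P.mul x) f))
    rw [Derivation.commutator_apply]
    -- The cross terms of the Leibniz rule leave `lin v (xy) - lin v (yx)`, which accounts for
    -- multiplication by the bracket.
    simp only [map_add, Derivation.leibniz, extDer_lin, smul_eq_mul, map_sub]
    ring

theorem symRep_apply (x : g) (f : MvPolynomial B k) :
    P.symRep v x f = lin v x * f + extDer v (P.mul x) f := rfl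

/-- The action of the enveloping algebra on the symmetric algebra. -/
noncomputable def act :
    UniversalEnvelopingAlgebra k g →ₐ[k] Module.End k (MvPolynomial B k) :=
  lift k (P.symRep v)

theorem act_ι (x : g) : P.act v (ι k x) = P.symRep v x := lift_ι_apply k _ x

theorem hasSymbol_ι (x : g) : HasSymbol (P.act v (ι k x)) (lin v x) 1 := by
  refine ⟨lin_mem_degLT v x, fun {N f} hf => ?_⟩
  rw [act_ι, symRep_apply, add_sub_cancel_left]
  exact extDer_mem_degLT v _ hf

/-- The adjoint action of `g` on its symmetric algebra. -/
noncomputable def symAd (x : g) : Derivation k (MvPolynomial B k) (MvPolynomial B k) :=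
  extDer v (LieAlgebra.ad k g x)

/-- Both the commutator with `symAd v x` and the commutator with `ι x` obey the Leibniz rule in `u`,
so generators suffice; there `ad_lie_mul` applies. -/
theorem symAd_act (x : g) (u : UniversalEnvelopingAlgebra k g) :
    ∀ f, symAd v x (P.act v u f) =
      P.act v u (symAd v x f) + P.act v (ι k x * u - u * ι k x) f := by
  have hu : u ∈ Algebra.adjoin k (Set.range (ι k : g → UniversalEnvelopingAlgebra k g)) := by
    rw [adjoin_range_ι]; exact Algebra.mem_top
  induction hu using Algebra.adjoin_induction with
  | mem u hu =>
    obtain ⟨y, rfl⟩ := hu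
    intro f
    have h1 : ι k x * ι k y - ι k y * ι k x = ι k ⁅x, y⁆ := by
      rw [LieHom.map_lie, Ring.lie_def]
    have h2 : symAd v x (extDer v (P.mul y) f) =
        extDer v (P.mul y) (symAd v x f) + extDer v (P.mul ⁅x, y⁆) f := by
      rw [← P.ad_lie_mul, extDer_lie, Derivation.commutator_apply, symAd]
      ring
    rw [h1]
    simp only [act_ι, symRep_apply, map_add, h2, Derivation.leibniz, smul_eq_mul]
    have h3 : symAd v x (lin v y) = lin v ⁅x, y⁆ := extDer_lin v _ y
    rw [h3]
    ring
  | algebraMap r =>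
    intro f
    rw [Algebra.commutes, sub_self, map_zero, LinearMap.zero_apply, add_zero, AlgHom.commutes]
    simp [Module.algebraMap_end_apply]
  | add a b _ _ ha hb =>
    intro f
    rw [map_add, LinearMap.add_apply, map_add, ha, hb, mul_add, add_mul, add_sub_add_comm, map_add]
    simp only [LinearMap.add_apply]
    abel
  | mul a b _ _ ha hb =>
    intro f
    have : ι k x * (a * b) - a * b * ι k x =
      (ι k x * a - a * ι k x) * b + a * (ι k x * b - b * ι k x) := by noncomm_ring
    rw [this, map_mul, Module.End.mul_apply, ha, hb]
    simp only [map_add, map_mul, LinearMap.add_apply, Module.End.mul_apply]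
    abel

/-- The map `u ↦ u · 1` from the enveloping algebra to the symmetric algebra. -/
noncomputable def toSym : UniversalEnvelopingAlgebra k g →ₗ[k] MvPolynomial B k :=
  LinearMap.applyₗ 1 ∘ₗ (P.act v).toLinearMap

theorem toSym_apply (u : UniversalEnvelopingAlgebra k g) : P.toSym v u = P.act v u 1 := rfl

theorem symAd_toSym (x : g) (u : UniversalEnvelopingAlgebra k g) :
    symAd v x (P.toSym v u) = P.toSym v (ι k x * u - u * ι k x) := by
  rw [toSym_apply, symAd_act, Derivation.map_one_eq_zero, map_zero, zero_add, toSym_apply]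

/-- The product in the enveloping algebra of a list of basis vectors. -/
noncomputable def word (l : List B) : UniversalEnvelopingAlgebra k g :=
  (l.map fun b => ι k (v b)).prod

theorem word_cons (b : B) (l : List B) : word v (b :: l) = ι k (v b) * word v l := by
  simp [word]

theorem hasSymbol_word [DecidableEq B] (l : List B) :
    HasSymbol (P.act v (word v l)) (monomial (Multiset.toFinsupp (l : Multiset B)) 1) l.length := by
  induction l with
  | nil =>
    rw [word, List.map_nil, List.prod_nil, map_one]
    exact .one
  | cons b l ih =>
    have h := (P.hasSymbol_ι v (v b)).mul ih
    rw [lin_basis, ← map_mul, ← word_cons, X, monomial_mul, one_mul, add_comm 1] at h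
    rw [← Multiset.cons_coe, ← Multiset.singleton_add, map_add, Multiset.toFinsupp_singleton]
    exact h

/-- The span of the words of length less than `N`. -/
def wordLT (N : ℕ) : Submodule k (UniversalEnvelopingAlgebra k g) :=
  Submodule.span k (word v '' {l | l.length < N})

theorem word_mem_wordLT {l : List B} {N : ℕ} (h : l.length < N) : word v l ∈ wordLT v N :=
  Submodule.subset_span ⟨l, h, rfl⟩

theorem wordLT_mono {M N : ℕ} (h : M ≤ N) : wordLT v M ≤ wordLT v N :=
  Submodule.span_mono (Set.image_mono fun _ hl => lt_of_lt_of_le hl h)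

theorem ι_mul_mem_wordLT (x : g) {N : ℕ} {u : UniversalEnvelopingAlgebra k g}
    (hu : u ∈ wordLT v N) : ι k x * u ∈ wordLT v (N + 1) := by
  induction hu using Submodule.span_induction with
  | mem u hu =>
    obtain ⟨l, hl, rfl⟩ := hu
    rw [← v.linearCombination_repr x, Finsupp.linearCombination_apply, Finsupp.sum, map_sum,
      Finset.sum_mul]
    refine Submodule.sum_mem _ fun b _ => ?_
    rw [map_smul, smul_mul_assoc, ← word_cons]
    refine Submodule.smul_mem _ _ (word_mem_wordLT v ?_)
    simpa using hl
  | zero => rw [mul_zero]; exact Submodule.zero_mem _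
  | add a b _ _ ha hb => rw [mul_add]; exact Submodule.add_mem _ ha hb
  | smul c a _ ha => rw [mul_smul_comm]; exact Submodule.smul_mem _ _ ha

/-- Swapping two adjacent letters costs their bracket, a combination of single letters, hence of
shorter words. -/
theorem word_sub_word_mem {l l' : List B} (h : l.Perm l') :
    word v l - word v l' ∈ wordLT v l.length := by
  induction h with
  | nil => rw [sub_self]; exact Submodule.zero_mem _
  | cons b _ ih =>
    rw [word_cons, word_cons, ← mul_sub]
    exact ι_mul_mem_wordLT v _ ih
  | swap a b l =>
    rw [word_cons, word_cons, word_cons, word_cons, ← mul_assoc, ← mul_assoc, ← sub_mul,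
      ← Ring.lie_def, ← LieHom.map_lie]
    exact ι_mul_mem_wordLT v _ (word_mem_wordLT v (Nat.lt_succ_self _))
  | trans h _ ih ih' =>
    rw [← sub_add_sub_cancel]
    rw [← h.length_eq] at ih'
    exact Submodule.add_mem _ ih ih'

theorem exists_mem_wordLT (u : UniversalEnvelopingAlgebra k g) : ∃ N, u ∈ wordLT v N := by
  have hu : u ∈ Algebra.adjoin k (Set.range (ι k : g → UniversalEnvelopingAlgebra k g)) := by
    rw [adjoin_range_ι]; exact Algebra.mem_top
  -- Generalised to left multiplication by `u`, so that the product case is a composition; the empty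
  -- word recovers the claim.
  suffices ∀ w N, w ∈ wordLT v N → ∃ M, u * w ∈ wordLT v M by
    simpa [word] using this (word v []) 1 (word_mem_wordLT v (by simp))
  induction hu using Algebra.adjoin_induction with
  | mem u hu =>
    obtain ⟨x, rfl⟩ := hu
    exact fun w N hw => ⟨N + 1, ι_mul_mem_wordLT v x hw⟩
  | algebraMap r =>
    refine fun w N hw => ⟨N, ?_⟩
    rw [← Algebra.smul_def]
    exact Submodule.smul_mem _ _ hw
  | add a b _ _ ha hb =>
    intro w N hw
    obtain ⟨M, hM⟩ := ha w N hw
    obtain ⟨M', hM'⟩ := hb w N hw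
    refine ⟨max M M', ?_⟩
    rw [add_mul]
    exact Submodule.add_mem _ (wordLT_mono v (le_max_left _ _) hM)
      (wordLT_mono v (le_max_right _ _) hM')
  | mul a b _ _ ha hb =>
    intro w N hw
    obtain ⟨M, hM⟩ := hb w N hw
    obtain ⟨M', hM'⟩ := ha _ M hM
    exact ⟨M', by rwa [mul_assoc]⟩

/-- The linear map sending a monomial to the product of its factors in some order. -/
noncomputable def ofSym : MvPolynomial B k →ₗ[k] UniversalEnvelopingAlgebra k g :=
  (basisMonomials B k).constr k fun m => word v (Finsupp.toMultiset m).toList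

theorem ofSym_monomial (m : B →₀ ℕ) :
    ofSym v (monomial m 1) = word v (Finsupp.toMultiset m).toList := by
  have := (basisMonomials B k).constr_basis k (fun m => word v (Finsupp.toMultiset m).toList) m
  rwa [coe_basisMonomials] at this

theorem wordLT_le_range_ofSym (N : ℕ) : wordLT v N ≤ LinearMap.range (ofSym v) := by
  classical
  induction N with
  | zero =>
    rw [wordLT, Submodule.span_le]
    rintro _ ⟨l, hl, -⟩
    exact absurd hl (Nat.not_lt_zero _)
  | succ N ih =>
    rw [wordLT, Submodule.span_le]
    rintro _ ⟨l, hl, rfl⟩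
    have h1 : l.Perm (l : Multiset B).toList :=
      Multiset.coe_eq_coe.1 (Multiset.coe_toList _).symm
    have h2 := ofSym_monomial v (Multiset.toFinsupp (l : Multiset B))
    rw [Multiset.toFinsupp_toMultiset] at h2
    have h3 := ih (wordLT_mono v (Nat.lt_succ_iff.1 hl) (word_sub_word_mem v h1))
    rw [← h2] at h3
    have h4 := Submodule.add_mem _ h3 (LinearMap.mem_range_self (ofSym v)
      (monomial (Multiset.toFinsupp (l : Multiset B)) 1))
    rwa [sub_add_cancel] at h4

theorem ofSym_surjective : Function.Surjective (ofSym v) := fun u => by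
  obtain ⟨N, hN⟩ := exists_mem_wordLT v u
  exact wordLT_le_range_ofSym v N hN

theorem toSym_ofSym_sub_mem {N : ℕ} {f : MvPolynomial B k} (hf : f ∈ degLT k B (N + 1)) :
    P.toSym v (ofSym v f) - f ∈ degLT k B N := by
  classical
  refine sub_mem_degLT_of_monomial (P.toSym v ∘ₗ ofSym v) LinearMap.id Finsupp.degree
    (fun m => ?_) (mem_degLT.1 hf)
  have h := (P.hasSymbol_word v (Finsupp.toMultiset m).toList).sub_apply_one_mem
  rw [Multiset.coe_toList, Finsupp.toMultiset_toFinsupp, Multiset.length_toList,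
    ← ofSym_monomial, Finsupp.card_toMultiset] at h
  exact h

/-- Since `toSym ∘ ofSym` is the identity modulo lower degree, any `f` in its kernel has ever
smaller degree; `ofSym` is onto. -/
theorem toSym_injective : Function.Injective (P.toSym v) := by
  rw [injective_iff_map_eq_zero]
  intro u hu
  obtain ⟨f, rfl⟩ := ofSym_surjective v u
  suffices ∀ N, f ∈ degLT k B N → f = 0 by
    obtain ⟨N, hN⟩ := exists_mem_degLT f
    rw [this _ hN, map_zero]
  intro N
  induction N with
  | zero => rw [degLT_zero]; exact fun h => h
  | succ N ih =>
    intro hf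
    have := P.toSym_ofSym_sub_mem v hf
    rw [hu, zero_sub, Submodule.neg_mem_iff] at this
    exact ih this

end AssocProduct

/-! ### Powers of the adjoint action in characteristic `p`. -/

theorem LieHom.map_ad_pow {k g g' : Type*} [CommRing k] [LieRing g] [LieAlgebra k g] [LieRing g']
    [LieAlgebra k g'] (f : g →ₗ⁅k⁆ g') (x y : g) (n : ℕ) :
    f ((LieAlgebra.ad k g x ^ n) y) = (LieAlgebra.ad k g' (f x) ^ n) (f y) := by
  induction n with
  | zero => rfl
  | succ n ih =>
    rw [pow_succ', pow_succ', Module.End.mul_apply, Module.End.mul_apply, LieAlgebra.ad_apply,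
      LieAlgebra.ad_apply, LieHom.map_lie, ih]

/-- Left and right multiplication by `a` commute, so the `p`-th power of their difference is the
difference of their `p`-th powers. -/
theorem ad_pow_char {k A : Type*} [Field k] [Ring A] [Algebra k A] [Nontrivial A] (p : ℕ)
    [Fact p.Prime] [CharP k p] (a b : A) :
    (LieAlgebra.ad k A a ^ p) b = a ^ p * b - b * a ^ p := by
  have : CharP (Module.End k A) p :=
    charP_of_injective_algebraMap (algebraMap k (Module.End k A)).injective p
  have h : (LieAlgebra.ad k A a : Module.End k A) =
      LinearMap.mulLeft k a - LinearMap.mulRight k a := by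
    ext b; rfl
  rw [h, sub_pow_char_of_commute p (LinearMap.commute_mulLeft_right a a),
    LinearMap.pow_mulLeft, LinearMap.pow_mulRight]
  rfl

/-! ### Invariants of the symmetric algebra and a leading-term criterion for free generation of the
centre. -/

namespace AssocProduct

variable {k g B : Type*} [Field k] [LieRing g] [LieAlgebra k g]
  (P : AssocProduct k g) (v : Module.Basis B k g)

theorem nontrivial_universalEnvelopingAlgebra (P : AssocProduct k g) (v : Module.Basis B k g) :
    Nontrivial (UniversalEnvelopingAlgebra k g) :=
  (P.act v).toRingHom.domain_nontrivial

theorem hasSymbol_pow_sub (b : B) (y : g) {p : ℕ} (hp : 1 < p) :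
    HasSymbol (P.act v (ι k (v b) ^ p - ι k y)) (X b ^ p) p := by
  have h := (P.hasSymbol_ι v (v b)).pow p
  rw [mul_one, lin_basis] at h
  rw [map_sub, map_pow]
  exact h.sub_of_lt (P.hasSymbol_ι v y) hp

/-- The derivation of the symmetric algebra extending a linear functional on `g`. -/
noncomputable def dualDer (l : g →ₗ[k] k) : Derivation k (MvPolynomial B k) (MvPolynomial B k) :=
  mkDerivation k fun b => C (l (v b))

theorem dualDer_lin (l : g →ₗ[k] k) (x : g) : dualDer v l (lin v x) = C (l x) := by
  have : (dualDer v l).toLinearMap ∘ₗ lin v = Algebra.linearMap k _ ∘ₗ l := v.ext fun b => by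
    change dualDer v l (lin v (v b)) = _
    rw [lin_basis, dualDer, mkDerivation_X]
    rfl
  exact DFunLike.congr_fun this x

theorem dualDer_comp_ad (l : g →ₗ[k] k) (x : g) :
    dualDer v (l ∘ₗ LieAlgebra.ad k g x) = ⁅dualDer v l, symAd v x⁆ :=
  derivation_ext fun b => by
    rw [Derivation.commutator_apply, ← lin_basis v b, symAd, extDer_lin]
    simp only [dualDer_lin, derivation_C, sub_zero]
    rfl

/-- The derivation is the commutator of `dualDer v l` and `symAd v x`, and both kill `f`: the first
kills its variables, the second by invariance. -/
theorem dualDer_comp_ad_eq_zero {l : g →ₗ[k] k} {x : g} {f : MvPolynomial B k}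
    (hl : ∀ b ∈ f.vars, l (v b) = 0) (hx : symAd v x f = 0) :
    dualDer v (l ∘ₗ LieAlgebra.ad k g x) f = 0 := by
  have h : dualDer v l f = 0 := derivation_eq_zero_of_forall_mem_vars fun b hb => by
    rw [dualDer, mkDerivation_X, hl b hb, C_0]
  rw [dualDer_comp_ad, Derivation.commutator_apply, h, hx, map_zero, map_zero, sub_zero]

theorem dualDer_coord [DecidableEq B] (b : B) {l : g →ₗ[k] k}
    (hl : ∀ c, l (v c) = if b = c then 1 else 0) : dualDer v l = pderiv b :=
  derivation_ext fun c => by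
    rw [dualDer, mkDerivation_X, hl, pderiv_X, Pi.single_apply]
    simp [eq_comm]

variable {c : B → Subalgebra.center k (UniversalEnvelopingAlgebra k g)} {w : B → ℕ}

theorem hasSymbol_aeval_monomial
    (hs : ∀ b, HasSymbol (P.act v (c b)) (X b ^ w b) (w b)) (m : B →₀ ℕ) :
    HasSymbol (P.act v (aeval c (monomial m (1 : k)) : Subalgebra.center k _))
      (monomial (scaleExp w m) 1) (scaleExp w m).degree := by
  induction m using Finsupp.induction_linear with
  | zero =>
    rw [map_zero, map_zero, ← one_def, map_one, OneMemClass.coe_one, map_one]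
    exact .one
  | add m m' h h' =>
    have := h.mul h'
    rwa [monomial_mul, one_mul, ← map_mul, ← MulMemClass.coe_mul, ← map_mul, monomial_mul,
      one_mul, ← map_add, ← map_add, ← map_add] at this
  | single b n =>
    have := (hs b).pow n
    rw [← map_pow, ← SubmonoidClass.coe_pow, ← aeval_X (R := k) c b, ← map_pow, ← pow_mul,
      X_pow_eq_monomial, X_pow_eq_monomial] at this
    rw [mul_comm n] at this
    rwa [scaleExp_single, Finsupp.degree_single]

theorem toSym_aeval_sub_mem
    (hs : ∀ b, HasSymbol (P.act v (c b)) (X b ^ w b) (w b)) (hw : ∀ b, w b ≠ 0) {N : ℕ}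
    {f : MvPolynomial B k} (hf : scale w f ∈ degLT k B (N + 1)) :
    P.toSym v (aeval c f : Subalgebra.center k _) - scale w f ∈ degLT k B N := by
  refine sub_mem_degLT_of_monomial
    (P.toSym v ∘ₗ (Subalgebra.val _).toLinearMap ∘ₗ (aeval c : _ →ₐ[k] _).toLinearMap) (scale w)
    (fun m => (scaleExp w m).degree) (fun m => ?_) fun m hm => ?_
  · rw [scale_monomial]
    exact (P.hasSymbol_aeval_monomial v hs m).sub_apply_one_mem
  · refine mem_degLT.1 hf _ ?_
    rw [mem_support_iff] at hm ⊢
    rwa [coeff_scale hw]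

theorem aeval_injective
    (hs : ∀ b, HasSymbol (P.act v (c b)) (X b ^ w b) (w b)) (hw : ∀ b, w b ≠ 0) :
    Function.Injective (aeval c : MvPolynomial B k →ₐ[k] _) := by
  rw [injective_iff_map_eq_zero]
  intro f hf
  suffices ∀ N, scale w f ∈ degLT k B N → scale w f = 0 by
    obtain ⟨N, hN⟩ := exists_mem_degLT (scale w f)
    exact scale_injective hw ((this _ hN).trans (map_zero _).symm)
  intro N
  induction N with
  | zero => rw [degLT_zero]; exact fun h => h
  | succ N ih =>
    intro h
    have := P.toSym_aeval_sub_mem v hs hw h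
    rw [hf, ZeroMemClass.coe_zero, map_zero, zero_sub, Submodule.neg_mem_iff] at this
    exact ih this

theorem symAd_toSym_center (x : g)
    (u : Subalgebra.center k (UniversalEnvelopingAlgebra k g)) :
    symAd v x (P.toSym v u) = 0 := by
  rw [symAd_toSym, Subalgebra.mem_center_iff.1 u.2, sub_self, map_zero]

/-- An invariant `scale w h` agrees with the image of the central element `aeval c h` up to lower
degree; the difference is again invariant, so induction on degree applies. -/
theorem aeval_surjective
    (hs : ∀ b, HasSymbol (P.act v (c b)) (X b ^ w b) (w b)) (hw : ∀ b, w b ≠ 0)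
    (hinv : ∀ f, (∀ x, symAd v x f = 0) → ∃ h, scale w h = f) :
    Function.Surjective (aeval c : MvPolynomial B k →ₐ[k] _) := by
  suffices ∀ N f, f ∈ degLT k B N → (∀ x, symAd v x f = 0) →
      ∃ h, P.toSym v (aeval c h : Subalgebra.center k _) = f by
    intro u
    obtain ⟨N, hN⟩ := exists_mem_degLT (P.toSym v u)
    obtain ⟨h, hh⟩ := this _ _ hN fun x => P.symAd_toSym_center v x u
    exact ⟨h, Subtype.ext (P.toSym_injective v hh)⟩
  intro N
  induction N with
  | zero =>
    intro f hf _
    rw [degLT_zero, Submodule.mem_bot] at hf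
    exact ⟨0, by rw [hf, map_zero, ZeroMemClass.coe_zero, map_zero]⟩
  | succ N ih =>
    intro f hf hx
    obtain ⟨h, rfl⟩ := hinv f hx
    obtain ⟨h', hh'⟩ := ih _ (P.toSym_aeval_sub_mem v hs hw hf) fun x => by
      rw [map_sub, hx, symAd_toSym_center, sub_zero]
    refine ⟨h - h', ?_⟩
    rw [map_sub, AddSubgroupClass.coe_sub, map_sub, hh', sub_sub_cancel]

end AssocProduct

/-! ### Matrix product, entries and brackets in `𝔤_σ`. -/

namespace shiftedCurrentAlgebra

variable (k : Type*) [Field k] {n : ℕ} (σ : ShiftMatrix n)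

/-- Matrix multiplication on `𝔤_σ`. -/
noncomputable def matMul : AssocProduct k (shiftedCurrentAlgebra k σ) where
  mul := LinearMap.mk₂ k
    (fun x y => ⟨(x : CurrentAlgebra k n) * y, mul_mem_shiftedSpan σ x.2 y.2⟩)
    (fun _ _ _ => Subtype.ext (add_mul _ _ _)) (fun _ _ _ => Subtype.ext (smul_mul_assoc _ _ _))
    (fun _ _ _ => Subtype.ext (mul_add _ _ _)) (fun _ _ _ => Subtype.ext (mul_smul_comm _ _ _))
  assoc _ _ _ := Subtype.ext (mul_assoc _ _ _)
  lie_eq _ _ := Subtype.ext (Ring.lie_def _ _)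

/-- The coefficient of `t^r` in the `(i, j)` entry. -/
noncomputable def entry (i j : Fin n) (r : ℕ) : shiftedCurrentAlgebra k σ →ₗ[k] k where
  toFun x := ((x : CurrentAlgebra k n) i j).coeff r
  map_add' _ _ := Polynomial.coeff_add _ _ _
  map_smul' _ _ := Polynomial.coeff_smul _ _ _

theorem entry_apply (i j : Fin n) (r : ℕ) (x : shiftedCurrentAlgebra k σ) :
    entry k σ i j r x = ((x : CurrentAlgebra k n) i j).coeff r := rfl

theorem entry_e (a b : Fin n) (m : ℕ) (i j : Fin n) (r : ℕ) (h : σ.s i j ≤ r) :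
    entry k σ a b m (e k σ i j r h) = if i = a ∧ j = b ∧ r = m then 1 else 0 := by
  change (Matrix.single i j (Polynomial.X ^ r) a b : Polynomial k).coeff m = _
  rw [Matrix.single_apply]
  by_cases h1 : i = a ∧ j = b
  · simp [h1, Polynomial.coeff_X_pow, eq_comm]
  · rw [if_neg h1, if_neg fun h2 => h1 ⟨h2.1, h2.2.1⟩, Polynomial.coeff_zero]

theorem entry_z (a b : Fin n) (m r : ℕ) :
    entry k σ a b m (z k σ r) = if a = b ∧ r = m then 1 else 0 := by
  rw [z, map_sum]
  simp only [entry_e]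
  rw [Finset.sum_eq_single a (fun i _ hi => if_neg fun h => hi h.1) (by simp)]
  simp

theorem entry_lie_e (i j a b : Fin n) (r s : ℕ) (h : σ.s i j ≤ r)
    (y : shiftedCurrentAlgebra k σ) :
    entry k σ a b (s + r) ⁅e k σ i j r h, y⁆ =
      (if a = i then entry k σ j b s y else 0) - (if b = j then entry k σ a i s y else 0) := by
  have h1 : (((e k σ i j r h : CurrentAlgebra k n) * y) a b).coeff (s + r) =
      if a = i then entry k σ j b s y else 0 := by
    change ((Matrix.single i j (Polynomial.X ^ r) * (y : CurrentAlgebra k n) : CurrentAlgebra k n) a b).coeff _ = _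
    split_ifs with ha
    · rw [ha, Matrix.single_mul_apply_same, Polynomial.coeff_X_pow_mul, entry_apply]
    · rw [Matrix.single_mul_apply_of_ne _ _ _ _ _ ha, Polynomial.coeff_zero]
  have h2 : (((y : CurrentAlgebra k n) * e k σ i j r h) a b).coeff (s + r) =
      if b = j then entry k σ a i s y else 0 := by
    change (((y : CurrentAlgebra k n) * Matrix.single i j (Polynomial.X ^ r) : CurrentAlgebra k n) a b).coeff _ = _
    split_ifs with hb
    · rw [hb, Matrix.mul_single_apply_same, Polynomial.coeff_mul_X_pow, entry_apply]
    · rw [Matrix.mul_single_apply_of_ne _ _ _ _ _ hb, Polynomial.coeff_zero]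
  rw [← h1, ← h2, ← Polynomial.coeff_sub]
  rfl

theorem lie_z (r : ℕ) (x : shiftedCurrentAlgebra k σ) : ⁅x, z k σ r⁆ = 0 := by
  have h : (z k σ r : CurrentAlgebra k n) = Matrix.scalar (Fin n) (Polynomial.X ^ r) := by
    rw [Matrix.scalar_apply, ← Matrix.sum_single_eq_diagonal, z, AddSubmonoidClass.coe_finsetSum]
    rfl
  refine Subtype.ext ?_
  change ⁅(x : CurrentAlgebra k n), (z k σ r : CurrentAlgebra k n)⁆ = 0
  rw [h, Ring.lie_def, (Matrix.scalar_commute _ (fun _ => Commute.all _ _) _).eq, sub_self]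

/-! ### A basis containing the `z_r`, and the invariants. -/

section Basis

variable [NeZero n]

/-- The basis vectors of `𝔤_σ`: the `z_r`, and the `e_{i,j} t^r` with `(i, j) ≠ (1, 1)`. -/
noncomputable def basisVec : ℕ ⊕ Index σ → shiftedCurrentAlgebra k σ
  | Sum.inl r => z k σ r
  | Sum.inr ⟨(i, j, r), h⟩ => e k σ i j r h.2

/-- The functionals dual to `basisVec`. -/
noncomputable def coord : ℕ ⊕ Index σ → shiftedCurrentAlgebra k σ →ₗ[k] k
  | Sum.inl r => entry k σ 0 0 r
  | Sum.inr ⟨(i, j, r), _⟩ =>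
    if i = j then entry k σ i j r - entry k σ 0 0 r else entry k σ i j r

-- Each `z_r` has equal diagonal entries, so a diagonal coordinate must subtract the `(0, 0)` entry
-- in order to vanish on it.
open Classical in
theorem coord_basisVec (b c : ℕ ⊕ Index σ) :
    coord k σ b (basisVec k σ c) = if b = c then 1 else 0 := by
  rcases b with r | ⟨⟨i, j, r⟩, h⟩ <;> rcases c with s | ⟨⟨a, b, s⟩, h'⟩
  · simp [coord, basisVec, entry_z, eq_comm]
  · simp only [coord, basisVec, entry_e, reduceCtorEq, if_false]
    exact if_neg fun h1 => h'.1 (by simp [h1.1, h1.2.1])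
  · simp only [coord, basisVec, reduceCtorEq, if_false]
    split_ifs with hij
    · simp [entry_z, hij]
    · simp [entry_z, hij]
  · have h0 : ¬ (a = 0 ∧ b = 0 ∧ s = r) := fun h1 => h'.1 (by simp [h1.1, h1.2.1])
    have h2 : (Sum.inr ⟨(i, j, r), h⟩ : ℕ ⊕ Index σ) = Sum.inr ⟨(a, b, s), h'⟩ ↔
        a = i ∧ b = j ∧ s = r := by
      refine Sum.inr.inj_iff.trans (Subtype.ext_iff.trans ?_)
      rw [Prod.mk.injEq, Prod.mk.injEq]
      simp only [eq_comm]
    simp only [coord, basisVec, h2]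
    split_ifs with hij h3 h3
    · rw [LinearMap.sub_apply, entry_e, entry_e, if_neg h0, if_pos h3, sub_zero]
    · rw [LinearMap.sub_apply, entry_e, entry_e, if_neg h0, if_neg h3, sub_zero]
    · rw [entry_e, if_pos h3]
    · rw [entry_e, if_neg h3]

theorem linearIndependent_basisVec : LinearIndependent k (basisVec k σ) := by
  classical
  rw [linearIndependent_iff]
  intro l hl
  ext b
  have h := congrArg (coord k σ b) hl
  rw [Finsupp.linearCombination_apply, Finsupp.sum, map_sum, map_zero] at h
  simpa [coord_basisVec] using h

theorem e_mem_span_basisVec (i j : Fin n) (r : ℕ) (h : σ.s i j ≤ r) :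
    e k σ i j r h ∈ Submodule.span k (Set.range (basisVec k σ)) := by
  have key : ∀ (i j : Fin n) (h : σ.s i j ≤ r), (i, j) ≠ (0, 0) →
      e k σ i j r h ∈ Submodule.span k (Set.range (basisVec k σ)) :=
    fun i j h hij => Submodule.subset_span ⟨Sum.inr ⟨(i, j, r), hij, h⟩, rfl⟩
  by_cases hij : (i, j) = (0, 0)
  · obtain ⟨rfl, rfl⟩ := Prod.mk.inj hij
    have hz : z k σ r ∈ Submodule.span k (Set.range (basisVec k σ)) :=
      Submodule.subset_span ⟨Sum.inl r, rfl⟩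
    rw [z, ← Finset.add_sum_erase _ _ (Finset.mem_univ (0 : Fin n))] at hz
    refine (Submodule.add_mem_iff_left _ (Submodule.sum_mem _ fun i hi => ?_)).1 hz
    exact key i i _ fun h0 => (Finset.mem_erase.1 hi).1 (Prod.mk.inj h0).1
  · exact key i j h hij

theorem span_basisVec : ⊤ ≤ Submodule.span k (Set.range (basisVec k σ)) := by
  have h : shiftedSpan k σ ≤ (Submodule.span k (Set.range (basisVec k σ))).map
      (shiftedCurrentAlgebra k σ).toSubmodule.subtype := by
    refine Submodule.span_le.2 ?_
    rintro _ ⟨i, j, r, hr, rfl⟩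
    exact ⟨_, e_mem_span_basisVec k σ i j r hr, rfl⟩
  intro x _
  obtain ⟨y, hy, hyx⟩ := h x.2
  rwa [← show y = x from Subtype.ext hyx]

/-- The basis of `𝔤_σ` consisting of the `z_r` and of the `e_{i,j} t^r` with `(i, j) ≠ (1, 1)`. -/
noncomputable def basis : Module.Basis (ℕ ⊕ Index σ) k (shiftedCurrentAlgebra k σ) :=
  .mk (linearIndependent_basisVec k σ) (span_basisVec k σ)

theorem basis_apply (b : ℕ ⊕ Index σ) : basis k σ b = basisVec k σ b :=
  Module.Basis.mk_apply _ _ b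

/-- The `t`-degree of a basis vector. -/
def tDegree : ℕ ⊕ Index σ → ℕ
  | Sum.inl r => r
  | Sum.inr b => b.1.2.2

theorem entry_basisVec_eq_zero (i j : Fin n) {m : ℕ} {b : ℕ ⊕ Index σ} (h : tDegree σ b < m) :
    entry k σ i j m (basisVec k σ b) = 0 := by
  rcases b with r | ⟨⟨a, b, s⟩, h'⟩
  · rw [basisVec, entry_z, if_neg fun h1 => ?_]
    exact absurd h1.2 (ne_of_lt h)
  · rw [basisVec, entry_e, if_neg fun h1 => ?_]
    exact absurd h1.2.2 (ne_of_lt h)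

/-- Bracketing with `e_{a,b} t^r` raises `t`-degrees by `r`, so the coefficient of `t^s` can be read
off at an arbitrarily high power of `t`. -/
theorem exists_coord_eq_comp_ad (b : Index σ) (N : ℕ) :
    ∃ (x : shiftedCurrentAlgebra k σ) (i j : Fin n) (m : ℕ), N < m ∧
      coord k σ (Sum.inr b) = entry k σ i j m ∘ₗ LieAlgebra.ad k _ x := by
  obtain ⟨⟨i, j, s⟩, h⟩ := b
  by_cases hij : i = j
  · subst hij
    -- The `(0, i)` entry of `[e_{0,i} t^r, y]` is `t^r (y_{i,i} - y_{0,0})`, the diagonal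
    -- coordinate; the summand `σ.s 0 i` keeps `e_{0,i} t^r` in `𝔤_σ`.
    have hr : σ.s 0 i ≤ N + 1 + σ.s 0 i := by omega
    refine ⟨e k σ 0 i _ hr, 0, i, s + (N + 1 + σ.s 0 i), by omega, LinearMap.ext fun y => ?_⟩
    rw [LinearMap.comp_apply, LieAlgebra.ad_apply, entry_lie_e, coord, if_pos rfl, if_pos rfl,
      if_pos rfl, LinearMap.sub_apply]
  · have hr : σ.s i i ≤ N + 1 := by rw [σ.diag]; omega
    refine ⟨e k σ i i _ hr, i, j, s + (N + 1), by omega, LinearMap.ext fun y => ?_⟩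
    rw [LinearMap.comp_apply, LieAlgebra.ad_apply, entry_lie_e, coord, if_neg hij, if_pos rfl,
      if_neg (Ne.symm hij), sub_zero]

theorem pderiv_eq_zero_of_invariant {f : MvPolynomial (ℕ ⊕ Index σ) k}
    (hf : ∀ x, AssocProduct.symAd (basis k σ) x f = 0) (b : Index σ) :
    pderiv (Sum.inr b) f = 0 := by
  classical
  -- The bound is the largest `t`-degree of a variable of `f`.
  obtain ⟨x, i, j, m, hm, h⟩ := exists_coord_eq_comp_ad k σ b (f.vars.sup (tDegree σ))
  rw [← AssocProduct.dualDer_coord (basis k σ) (Sum.inr b) (l := coord k σ (Sum.inr b))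
    fun c => by rw [basis_apply, coord_basisVec], h]
  refine AssocProduct.dualDer_comp_ad_eq_zero _ (fun c hc => ?_) (hf x)
  rw [basis_apply]
  exact entry_basisVec_eq_zero k σ i j (lt_of_le_of_lt (Finset.le_sup hc) hm)

end Basis

/-! ### Centrality and symbols of the generators, and the conclusion. -/

variable (p : ℕ)

/-- The degrees of the elements of `centreGen`. -/
def genDegree [NeZero n] : ℕ ⊕ Index σ → ℕ
  | Sum.inl _ => 1
  | Sum.inr _ => p

theorem exists_scale_eq_of_invariant [CharP k p] [NeZero n] {f : MvPolynomial (ℕ ⊕ Index σ) k}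
    (hf : ∀ x, AssocProduct.symAd (basis k σ) x f = 0) : ∃ h, scale (genDegree σ p) h = f := by
  refine mem_range_scale f fun m hm b => ?_
  rcases b with r | b
  · exact one_dvd _
  · exact dvd_of_pderiv_eq_zero p (pderiv_eq_zero_of_invariant k σ hf b) hm

theorem hasSymbol_centreGen [Fact p.Prime] [NeZero n] (b : ℕ ⊕ Index σ) :
    HasSymbol ((matMul k σ).act (basis k σ) (centreGen k σ p b)) (X b ^ genDegree σ p b)
      (genDegree σ p b) := by
  rcases b with r | ⟨⟨i, j, r⟩, h⟩
  · have := (matMul k σ).hasSymbol_ι (basis k σ) (basis k σ (Sum.inl r))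
    rw [AssocProduct.lin_basis, basis_apply] at this
    rw [genDegree, pow_one]
    exact this
  · have := (matMul k σ).hasSymbol_pow_sub (basis k σ) (Sum.inr ⟨(i, j, r), h⟩)
      (deltaE k σ i j (r * p)) (Fact.out : p.Prime).one_lt
    rw [basis_apply] at this
    exact this

theorem toU_z_mem_center (r : ℕ) : toU k σ (z k σ r) ∈ Subalgebra.center k (U k σ) := by
  rw [mem_center_iff_lie]
  intro x
  rw [← sub_eq_zero, ← Ring.lie_def, ← LieHom.map_lie, lie_z, map_zero]

variable {k}

theorem ad_pow_eq_ad_pMap [Fact p.Prime] [CharP k p] [NeZero n] (x y : shiftedCurrentAlgebra k σ) :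
    (LieAlgebra.ad k _ x ^ p) y = ⁅pMap σ p x, y⁆ := by
  refine Subtype.ext ?_
  refine ((shiftedCurrentAlgebra k σ).incl.map_ad_pow x y p).trans ?_
  rw [ad_pow_char]
  rfl

/-- In `U`, commutation with `x^p` is `(ad x)^p`, which on `𝔤_σ` equals `ad (x^[p])`, so the two
commutators cancel. -/
theorem pow_sub_pMap_mem_center [Fact p.Prime] [CharP k p] [NeZero n]
    (x : shiftedCurrentAlgebra k σ) :
    toU k σ x ^ p - toU k σ (pMap σ p x) ∈ Subalgebra.center k (U k σ) := by
  have : Nontrivial (U k σ) := (matMul k σ).nontrivial_universalEnvelopingAlgebra (basis k σ)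
  rw [mem_center_iff_lie]
  intro y
  have h := (toU k σ).map_ad_pow x y p
  rw [ad_pow_char, ad_pow_eq_ad_pMap, LieHom.map_lie, Ring.lie_def] at h
  rw [mul_sub, sub_mul, sub_eq_sub_iff_sub_eq_sub, ← neg_inj, neg_sub, ← h, neg_sub]

variable (k)

theorem pCentre_le_center [Fact p.Prime] [CharP k p] [NeZero n] :
    pCentre k σ p ≤ Subalgebra.center k (U k σ) := by
  rw [pCentre, Algebra.adjoin_le_iff]
  rintro _ ⟨x, rfl⟩
  exact pow_sub_pMap_mem_center σ p x

theorem pow_sub_deltaE_mem_pCentre [Fact p.Prime] (i j : Fin n) (r : ℕ) (h : σ.s i j ≤ r) :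
    toU k σ (e k σ i j r h) ^ p - toU k σ (deltaE k σ i j (r * p)) ∈ pCentre k σ p := by
  rw [← pMap_e σ p (Fact.out : p.Prime).two_le i j r h]
  exact Algebra.subset_adjoin ⟨e k σ i j r h, rfl⟩

theorem centreGen_mem_adjoin [Fact p.Prime] [NeZero n] (b : ℕ ⊕ Index σ) :
    centreGen k σ p b ∈ Algebra.adjoin k
      (Set.range (fun r : ℕ => toU k σ (z k σ r)) ∪ (pCentre k σ p : Set (U k σ))) := by
  refine Algebra.subset_adjoin ?_
  rcases b with r | ⟨⟨i, j, r⟩, h⟩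
  · exact Or.inl ⟨r, rfl⟩
  · exact Or.inr (pow_sub_deltaE_mem_pCentre k σ p i j r h.2)

theorem adjoin_le_center [Fact p.Prime] [CharP k p] [NeZero n] : Algebra.adjoin k
    (Set.range (fun r : ℕ => toU k σ (z k σ r)) ∪ (pCentre k σ p : Set (U k σ))) ≤
      Subalgebra.center k (U k σ) := by
  refine Algebra.adjoin_le (Set.union_subset ?_ (pCentre_le_center k σ p))
  rintro _ ⟨r, rfl⟩
  exact toU_z_mem_center k σ r

/-- The evaluation of polynomials at the elements of `centreGen`. -/
noncomputable def evalGen [Fact p.Prime] [CharP k p] [NeZero n] :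
    MvPolynomial (ℕ ⊕ Index σ) k →ₐ[k] Subalgebra.center k (U k σ) :=
  aeval fun b => ⟨centreGen k σ p b, adjoin_le_center k σ p (centreGen_mem_adjoin k σ p b)⟩

theorem genDegree_ne_zero [Fact p.Prime] [NeZero n] (b : ℕ ⊕ Index σ) : genDegree σ p b ≠ 0 := by
  rcases b with r | b
  · exact one_ne_zero
  · exact (Fact.out : p.Prime).ne_zero

theorem evalGen_bijective [Fact p.Prime] [CharP k p] [NeZero n] :
    Function.Bijective (evalGen k σ p) :=
  ⟨(matMul k σ).aeval_injective (basis k σ) (hasSymbol_centreGen k σ p) (genDegree_ne_zero σ p),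
    (matMul k σ).aeval_surjective (basis k σ) (hasSymbol_centreGen k σ p) (genDegree_ne_zero σ p)
      fun _ => exists_scale_eq_of_invariant k σ p⟩

theorem coe_evalGen_X [Fact p.Prime] [CharP k p] [NeZero n] (b : ℕ ⊕ Index σ) :
    (evalGen k σ p (X b) : U k σ) = centreGen k σ p b := by
  rw [evalGen, aeval_X]

theorem coe_evalGen_mem [Fact p.Prime] [CharP k p] [NeZero n] (f : MvPolynomial (ℕ ⊕ Index σ) k) :
    (evalGen k σ p f : U k σ) ∈ Algebra.adjoin k
      (Set.range (fun r : ℕ => toU k σ (z k σ r)) ∪ (pCentre k σ p : Set (U k σ))) := by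
  induction f using MvPolynomial.induction_on with
  | C a =>
    rw [← algebraMap_eq, AlgHom.commutes]
    exact Subalgebra.algebraMap_mem _ a
  | add f g hf hg =>
    rw [map_add]
    exact Subalgebra.add_mem _ hf hg
  | mul_X f b hf =>
    rw [map_mul, MulMemClass.coe_mul, coe_evalGen_X]
    exact Subalgebra.mul_mem _ hf (centreGen_mem_adjoin k σ p b)

end shiftedCurrentAlgebra

theorem mainTheorem5 {k : Type*} [Field k] (p : ℕ) [Fact p.Prime] [CharP k p]
    {n : ℕ} [NeZero n] (σ : ShiftMatrix n) :
    Subalgebra.center k (shiftedCurrentAlgebra.U k σ) =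
        Algebra.adjoin k
          (Set.range (fun r : ℕ => shiftedCurrentAlgebra.toU k σ (shiftedCurrentAlgebra.z k σ r)) ∪
            (shiftedCurrentAlgebra.pCentre k σ p : Set (shiftedCurrentAlgebra.U k σ))) ∧
      IsFreelyGeneratedBy (Subalgebra.center k (shiftedCurrentAlgebra.U k σ))
        (shiftedCurrentAlgebra.centreGen k σ p) := by
  refine ⟨le_antisymm (fun u hu => ?_) (shiftedCurrentAlgebra.adjoin_le_center k σ p),
    AlgEquiv.ofBijective _ (shiftedCurrentAlgebra.evalGen_bijective k σ p),
    shiftedCurrentAlgebra.coe_evalGen_X k σ p⟩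
  obtain ⟨f, hf⟩ := (shiftedCurrentAlgebra.evalGen_bijective k σ p).2 ⟨u, hu⟩
  have := shiftedCurrentAlgebra.coe_evalGen_mem k σ p f
  rwa [hf] at this
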